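/- Let $(F,g_F)$ be a smooth Riemannian manifold without boundary with $s=\dim F\ge 2$, let $f\colon F\to(0,\infty)$ be smooth, and let $I=(t_1,t_2)$ with $-\infty\le t_1<t_2\le\infty$. Let $M=I_f\times F$ be the standard static space-time, i.e. the manifold $I\times F$ with the Lorentzian metric $g=-f^2\,\mathrm dt^2\oplus g_F$, and let $\mathrm{Ric}$ be its Ricci tensor. On $(F,g_F)$ let $\mathrm{Ric}_{g_F}$ be the Ricci tensor, $H^f_{g_F}$ the Hessian of $f$, $\Delta_{g_F}f=\operatorname{tr}_{g_F}H^f_{g_F}$ the Laplacian, and put $$Q^f_{g_F}=\Delta_{g_F}f\;g_F-H^f_{g_F},\qquad \mathcal L^*_{g_F}f=-f\,\mathrm{Ric}_{g_F}-\Delta_{g_F}f\;g_F+H^f_{g_F}.$$ A symmetric $2$-covariant tensor $T$ on $F$ is called positive (negative) semi-definite if $T(v,v)\ge0$ (resp. $\le0$) for all tangent vectors $v$ at all points of $F$. A tangent vector $w$ of $M$ is time-like if $g(w,w)<0$, null if $w\ne0$ and $g(w,w)=0$, and causal if it is time-like or null. $M$ satisfies the TCC (resp. NCC) if $\mathrm{Ric}(w,w)\ge0$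 for all time-like (resp. null) vectors $w$, and the RTCC (resp. RNCC) if $\mathrm{Ric}(w,w)\le0$ for all time-like (resp. null) vectors $w$. Then: 1. $\mathcal L^*_{g_F}f$ is negative (respectively, positive) semi-definite if and only if $M$ satisfies the NCC (respectively, the RNCC). 2. If $\mathrm{Ric}_{g_F}$ and $Q^f_{g_F}$ are positive semi-definite, then $M$ satisfies the TCC and the NCC. 3. If $\mathrm{Ric}_{g_F}$ and $Q^f_{g_F}$ are negative semi-definite, then $\mathrm{Ric}(w,w)\le0$ for every causal vector $w\in TM$, i.e. $M$ satisfies the RNCC and the RTCC. 4. If $(F,g_F)$ is Ricci-flat, then $Q^f_{g_F}$ is positive semi-definite if and only if $M$ satisfies the NCC. -/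

import Mathlib

open scoped Manifold ContDiff Bundle

set_option maxSynthPendingDepth 3

noncomputable section

namespace StaticST

/-! ## Semi-Riemannian calculus in an open subset of a finite-dimensional real vector space

Below `G : E → E →L[ℝ] E →L[ℝ] ℝ` is a field of nondegenerate symmetric bilinear forms,
that is, a semi-Riemannian metric written in coordinates. -/

section Coordinates

variable {E : Type*} [NormedAddCommGroup E] [NormedSpace ℝ E]

/-- The inverse metric `G⁻¹ : E* → E` at `y` ("raising an index"). -/
def sharp (G : E → E →L[ℝ] E →L[ℝ] ℝ) (y : E) : (E →L[ℝ] ℝ) →L[ℝ] E :=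
  (G y).inverse

/-- Christoffel symbols of the first kind:
`christoffel₁ G y u v w = (∂_u G(v, w) + ∂_v G(u, w) - ∂_w G(u, v)) / 2`. -/
def christoffel₁ (G : E → E →L[ℝ] E →L[ℝ] ℝ) (y : E) :
    E →L[ℝ] E →L[ℝ] E →L[ℝ] ℝ :=
  letI D : E →L[ℝ] E →L[ℝ] E →L[ℝ] ℝ := fderiv ℝ G y
  letI T : (E →L[ℝ] E →L[ℝ] ℝ) →L[ℝ] E →L[ℝ] E →L[ℝ] ℝ :=
    ((ContinuousLinearMap.flipₗᵢ ℝ E E ℝ).toContinuousLinearEquiv).toContinuousLinearMap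
  letI K : E →L[ℝ] E →L[ℝ] E →L[ℝ] ℝ := T ∘L D.flip
  (2⁻¹ : ℝ) • (D + D.flip - K)

theorem christoffel₁_apply (G : E → E →L[ℝ] E →L[ℝ] ℝ) (y u v w : E) :
    christoffel₁ G y u v w =
      2⁻¹ * (fderiv ℝ G y u v w + fderiv ℝ G y v u w - fderiv ℝ G y w u v) := rfl

/-- Christoffel symbols of the second kind: for constant vector fields `u`, `v`,
`christoffel G y u v = ∇_u v` for the Levi-Civita connection `∇` of `G`. -/
def christoffel (G : E → E →L[ℝ] E →L[ℝ] ℝ) (y : E) : E →L[ℝ] E →L[ℝ] E :=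
  ContinuousLinearMap.compL ℝ E (E →L[ℝ] ℝ) E (sharp G y) ∘L christoffel₁ G y

theorem christoffel_apply (G : E → E →L[ℝ] E →L[ℝ] ℝ) (y u v : E) :
    christoffel G y u v = sharp G y (christoffel₁ G y u v) := rfl

/-- `curvature G y v w` is the endomorphism `u ↦ R(u, v) w`, where
`R(u, v) w = ∇_u ∇_v w - ∇_v ∇_u w - ∇_[u, v] w`. -/
def curvature (G : E → E →L[ℝ] E →L[ℝ] ℝ) (y v w : E) : E →L[ℝ] E :=
  ((fderiv ℝ (christoffel G) y).flip v).flip w - (fderiv ℝ (christoffel G) y v).flip w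
    + (christoffel G y).flip (christoffel G y v w)
    - (christoffel G y v) ∘L (christoffel G y).flip w

theorem curvature_apply (G : E → E →L[ℝ] E →L[ℝ] ℝ) (y u v w : E) :
    curvature G y v w u =
      fderiv ℝ (christoffel G) y u v w - fderiv ℝ (christoffel G) y v u w
        + christoffel G y u (christoffel G y v w)
        - christoffel G y v (christoffel G y u w) := rfl

/-- Ricci tensor in coordinates: `Ric(v, w) = trace (u ↦ R(u, v) w)`. -/
def ricciCoord (G : E → E →L[ℝ] E →L[ℝ] ℝ) (y v w : E) : ℝ :=
  LinearMap.trace ℝ E (curvature G y v w : E →ₗ[ℝ] E)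

/-- Hessian tensor `∇(dφ)` of a function `φ` in coordinates. -/
def hessCoord (G : E → E →L[ℝ] E →L[ℝ] ℝ) (φ : E → ℝ) (y : E) : E →L[ℝ] E →L[ℝ] ℝ :=
  fderiv ℝ (fderiv ℝ φ) y -
    ContinuousLinearMap.compL ℝ E E ℝ (fderiv ℝ φ y) ∘L christoffel G y

theorem hessCoord_apply (G : E → E →L[ℝ] E →L[ℝ] ℝ) (φ : E → ℝ) (y u v : E) :
    hessCoord G φ y u v =
      fderiv ℝ (fderiv ℝ φ) y u v - fderiv ℝ φ y (christoffel G y u v) := rfl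

/-- Laplace-Beltrami operator in coordinates: the metric trace of the Hessian. -/
def laplaceCoord (G : E → E →L[ℝ] E →L[ℝ] ℝ) (φ : E → ℝ) (y : E) : ℝ :=
  LinearMap.trace ℝ E (sharp G y ∘L hessCoord G φ y : E →L[ℝ] E)

/-- The pullback of a bilinear form under a linear map. -/
def pullForm {E' : Type*} [NormedAddCommGroup E'] [NormedSpace ℝ E']
    (A : E →L[ℝ] E') (B : E' →L[ℝ] E' →L[ℝ] ℝ) : E →L[ℝ] E →L[ℝ] ℝ :=
  B.bilinearComp A A

end Coordinates

/-! ## Tensors on manifolds without boundary -/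

section Manifold

/-- Fields of bilinear forms on the tangent spaces of `M` (`2`-covariant tensors). -/
abbrev BilinField {E : Type*} [NormedAddCommGroup E] [NormedSpace ℝ E]
    {H : Type*} [TopologicalSpace H] (I : ModelWithCorners ℝ E H)
    (M : Type*) [TopologicalSpace M] [ChartedSpace H M] : Type _ :=
  ∀ x : M, TangentSpace I x →L[ℝ] TangentSpace I x →L[ℝ] ℝ

variable {E : Type*} [NormedAddCommGroup E] [NormedSpace ℝ E]
  {H : Type*} [TopologicalSpace H] (I : ModelWithCorners ℝ E H)
  {M : Type*} [TopologicalSpace M] [ChartedSpace H M]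
  {E' : Type*} [NormedAddCommGroup E'] [NormedSpace ℝ E']
  {H' : Type*} [TopologicalSpace H'] (I' : ModelWithCorners ℝ E' H')
  {M' : Type*} [TopologicalSpace M'] [ChartedSpace H' M']

/-- The pullback `φ^* h`, `(φ^* h)_x(v, w) = h_{φ x}(dφ_x v, dφ_x w)`. -/
def pullback (φ : M → M') (h : BilinField I' M') : BilinField I M := fun x =>
  pullForm (E := E) (E' := E') (mfderiv I I' φ x) (h (φ x))

theorem pullback_apply (φ : M → M') (h : BilinField I' M') (x : M) (v w : TangentSpace I x) :
    pullback I I' φ h x v w = h (φ x) (mfderiv I I' φ x v) (mfderiv I I' φ x w) := rfl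

/-- The metric `g` written in the preferred chart of `M` at `p`. -/
def localMetric (g : BilinField I M) (p : M) : E → E →L[ℝ] E →L[ℝ] ℝ :=
  pullback 𝓘(ℝ, E) I (extChartAt I p).symm g

/-- Coordinates of a tangent vector at `p` in the preferred chart at `p`. -/
def coords (p : M) (v : TangentSpace I p) : E :=
  mfderiv I 𝓘(ℝ, E) (extChartAt I p) p v

/-- The Ricci tensor of the semi-Riemannian metric `g`, computed at each point `p` in a chart
around `p` (as for every tensor, the result does not depend on the chart). -/
def ricci (g : BilinField I M) (p : M) (v w : TangentSpace I p) : ℝ :=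
  ricciCoord (localMetric I g p) (extChartAt I p p) (coords I p v) (coords I p w)

/-- The Hessian tensor of `f` with respect to the semi-Riemannian metric `g`. -/
def hessian (g : BilinField I M) (f : M → ℝ) (p : M) (v w : TangentSpace I p) : ℝ :=
  hessCoord (localMetric I g p) (f ∘ (extChartAt I p).symm) (extChartAt I p p)
    (coords I p v) (coords I p w)

/-- The Laplace-Beltrami operator `Δ_g f = div grad f = trace_g (Hess f)`. -/
def laplacian (g : BilinField I M) (f : M → ℝ) (p : M) : ℝ :=
  laplaceCoord (localMetric I g p) (f ∘ (extChartAt I p).symm) (extChartAt I p p)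

/-- `Q^f_g = (Δ_g f) g - Hess_g f`. -/
def tensorQ (g : BilinField I M) (f : M → ℝ) (p : M) (v w : TangentSpace I p) : ℝ :=
  laplacian I g f p * g p v w - hessian I g f p v w

/-- `L^*_g f = - f Ric_g - (Δ_g f) g + Hess_g f`. -/
def tensorL (g : BilinField I M) (f : M → ℝ) (p : M) (v w : TangentSpace I p) : ℝ :=
  - f p * ricci I g p v w - laplacian I g f p * g p v w + hessian I g f p v w

variable {I}

/-- The quadratic form `v ↦ T(v, v)` is positive semi-definite at every point. -/
def PosSemidef (T : ∀ p : M, TangentSpace I p → TangentSpace I p → ℝ) : Prop :=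
  ∀ (p : M) (v : TangentSpace I p), 0 ≤ T p v v

/-- The quadratic form `v ↦ T(v, v)` is negative semi-definite at every point. -/
def NegSemidef (T : ∀ p : M, TangentSpace I p → TangentSpace I p → ℝ) : Prop :=
  ∀ (p : M) (v : TangentSpace I p), T p v v ≤ 0

variable (I)

/-- `(M, g)` is Ricci-flat. -/
def RicciFlat (g : BilinField I M) : Prop :=
  ∀ (p : M) (v w : TangentSpace I p), ricci I g p v w = 0

variable {I}

/-! ### Causal character and convergence conditions -/

/-- `v` is time-like. -/
def IsTimelike (g : BilinField I M) {p : M} (v : TangentSpace I p) : Prop :=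
  g p v v < 0

/-- `v` is null (light-like). -/
def IsNull (g : BilinField I M) {p : M} (v : TangentSpace I p) : Prop :=
  g p v v = 0 ∧ v ≠ 0

/-- `v` is causal. -/
def IsCausal (g : BilinField I M) {p : M} (v : TangentSpace I p) : Prop :=
  IsTimelike g v ∨ IsNull g v

/-- Time-like convergence condition. -/
def TCC (g : BilinField I M) : Prop :=
  ∀ (p : M) (v : TangentSpace I p), IsTimelike g v → 0 ≤ ricci I g p v v

/-- Null convergence condition. -/
def NCC (g : BilinField I M) : Prop :=
  ∀ (p : M) (v : TangentSpace I p), IsNull g v → 0 ≤ ricci I g p v v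

/-- Reverse time-like convergence condition. -/
def RTCC (g : BilinField I M) : Prop :=
  ∀ (p : M) (v : TangentSpace I p), IsTimelike g v → ricci I g p v v ≤ 0

/-- Reverse null convergence condition. -/
def RNCC (g : BilinField I M) : Prop :=
  ∀ (p : M) (v : TangentSpace I p), IsNull g v → ricci I g p v v ≤ 0

/-! ### Standard static space-times -/

/-- The open interval `(t₁, t₂)` of real numbers, with possibly infinite end points. -/
def interval (t₁ t₂ : EReal) : TopologicalSpace.Opens ℝ :=
  ⟨{t : ℝ | t₁ < (t : EReal) ∧ (t : EReal) < t₂},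
    (isOpen_lt continuous_const continuous_coe_real_ereal).inter
      (isOpen_lt continuous_coe_real_ereal continuous_const)⟩

/-- The standard metric `dt²` of the real line. -/
def lineMetric : BilinField 𝓘(ℝ, ℝ) ℝ := fun _ => ContinuousLinearMap.mul ℝ ℝ

variable (I)

/-- The metric `-f² dt² ⊕ g` of the standard static space-time `J_f × M`, where
`J = (t₁, t₂)`: the sum of `-f²` times the pullback of `dt²` under `(t, x) ↦ t` and of the pullback
of `g` under `(t, x) ↦ x`. -/
def staticMetric (t₁ t₂ : EReal) (f : M → ℝ) (g : BilinField I M) :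
    BilinField (𝓘(ℝ, ℝ).prod I) (interval t₁ t₂ × M) := fun p =>
  (-(f p.2) ^ 2) •
      pullback (𝓘(ℝ, ℝ).prod I) 𝓘(ℝ, ℝ) (fun q : interval t₁ t₂ × M => (q.1 : ℝ)) lineMetric p
    + pullback (𝓘(ℝ, ℝ).prod I) I (Prod.snd : interval t₁ t₂ × M → M) g p

end Manifold

end StaticST

end

open StaticST

namespace StaticST

open Filter Topology

section Coordinates

variable {E : Type*} [NormedAddCommGroup E] [NormedSpace ℝ E]

theorem fderiv_apply_apply {E₁ E₂ E₃ : Type*} [NormedAddCommGroup E₁] [NormedSpace ℝ E₁]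
    [NormedAddCommGroup E₂] [NormedSpace ℝ E₂] [NormedAddCommGroup E₃] [NormedSpace ℝ E₃]
    {B : E → E₁ →L[ℝ] E₂ →L[ℝ] E₃} {y : E} (hB : DifferentiableAt ℝ B y)
    (u : E) (v : E₁) (w : E₂) :
    fderiv ℝ B y u v w = fderiv ℝ (fun z => B z v w) y u := by
  have h := (hB.hasFDerivAt.clm_apply (hasFDerivAt_const v y)).clm_apply (hasFDerivAt_const w y)
  rw [h.fderiv]
  simp

theorem fderiv_symm_of_eventually {G : E → E →L[ℝ] E →L[ℝ] ℝ} {y : E}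
    (hG : DifferentiableAt ℝ G y) (hs : ∀ᶠ z in 𝓝 y, ∀ v w, G z v w = G z w v) (u v w : E) :
    fderiv ℝ G y u v w = fderiv ℝ G y u w v := by
  rw [fderiv_apply_apply hG, fderiv_apply_apply hG]
  congr 1
  apply EventuallyEq.fderiv_eq
  filter_upwards [hs] with z hz using hz v w

section Germs

variable {G G' : E → E →L[ℝ] E →L[ℝ] ℝ} {y : E}

theorem christoffel_congr (h : G =ᶠ[𝓝 y] G') : christoffel G =ᶠ[𝓝 y] christoffel G' := by
  filter_upwards [h, h.fderiv (𝕜 := ℝ)] with z hz hz'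
  simp only [christoffel, christoffel₁, sharp, hz, hz']

theorem ricciCoord_congr (h : G =ᶠ[𝓝 y] G') (v w : E) :
    ricciCoord G y v w = ricciCoord G' y v w := by
  have hc := christoffel_congr h
  simp only [ricciCoord, curvature, hc.eq_of_nhds, hc.fderiv_eq]

end Germs

variable {G : E → E →L[ℝ] E →L[ℝ] ℝ} {y : E}

theorem differentiableAt_christoffel₁ (hG : ContDiffAt ℝ 2 G y) :
    DifferentiableAt ℝ (christoffel₁ G) y := by
  have hD : DifferentiableAt ℝ (fderiv ℝ G) y :=
    (hG.fderiv_right (m := 1) (by norm_num)).differentiableAt (by simp)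
  have hF : DifferentiableAt ℝ (fun z => (fderiv ℝ G z).flip) y :=
    ((ContinuousLinearMap.flipₗᵢ ℝ E E
      (E →L[ℝ] ℝ)).toContinuousLinearEquiv.differentiableAt).comp y hD
  have hK : DifferentiableAt ℝ (fun z =>
      ((ContinuousLinearMap.flipₗᵢ ℝ E E ℝ).toContinuousLinearEquiv).toContinuousLinearMap ∘L
        (fderiv ℝ G z).flip) y :=
    (differentiableAt_const _).clm_comp hF
  exact ((hD.add hF).sub hK).const_smul (2⁻¹ : ℝ)

theorem curvature_eq_fderiv_apply (hΓ : DifferentiableAt ℝ (christoffel G) y) (u v w : E) :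
    curvature G y v w u =
      fderiv ℝ (fun z => christoffel G z v w) y u - fderiv ℝ (fun z => christoffel G z u w) y v
        + christoffel G y u (christoffel G y v w)
        - christoffel G y v (christoffel G y u w) := by
  rw [curvature_apply, fderiv_apply_apply hΓ, fderiv_apply_apply hΓ]

/-- The gradient of a function in coordinates. -/
noncomputable def gradCoord (G : E → E →L[ℝ] E →L[ℝ] ℝ) (φ : E → ℝ) (y : E) : E :=
  sharp G y (fderiv ℝ φ y)

theorem metric_gradCoord (hi : (G y).IsInvertible) (φ : E → ℝ) (w : E) :
    G y (gradCoord G φ y) w = fderiv ℝ φ y w :=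
  congrArg (fun l : E →L[ℝ] ℝ => l w) (hi.self_apply_inverse _)

theorem metric_christoffel (hi : (G y).IsInvertible) (u v w : E) :
    G y (christoffel G y u v) w = christoffel₁ G y u v w :=
  congrArg (fun l : E →L[ℝ] ℝ => l w) (hi.self_apply_inverse _)

variable [CompleteSpace E]

theorem eventually_isInvertible (hG : ContinuousAt G y) (hi : (G y).IsInvertible) :
    ∀ᶠ z in 𝓝 y, (G z).IsInvertible := by
  obtain ⟨e, he⟩ := hi
  have := e.nhds
  rw [he] at this
  filter_upwards [hG this] with z hz
  exact hz

theorem differentiableAt_sharp (hG : DifferentiableAt ℝ G y) (hi : (G y).IsInvertible) :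
    DifferentiableAt ℝ (sharp G) y :=
  ((hi.contDiffAt_map_inverse (n := 1)).differentiableAt (by simp)).comp y hG

theorem differentiableAt_christoffel (hG : ContDiffAt ℝ 2 G y) (hi : (G y).IsInvertible) :
    DifferentiableAt ℝ (christoffel G) y := by
  have h1 := differentiableAt_sharp (hG.differentiableAt (by norm_num)) hi
  exact ((ContinuousLinearMap.compL ℝ E (E →L[ℝ] ℝ) E).differentiableAt.comp y h1).clm_comp
    (differentiableAt_christoffel₁ hG)

/-- The covariant derivative of the gradient is the Hessian with an index raised. -/
theorem fderiv_gradCoord_add_christoffel {φ : E → ℝ} (hG : DifferentiableAt ℝ G y)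
    (hs : ∀ᶠ z in 𝓝 y, ∀ v w, G z v w = G z w v) (hi : (G y).IsInvertible)
    (hφ : ContDiffAt ℝ 2 φ y) (u : E) :
    fderiv ℝ (gradCoord G φ) y u + christoffel G y u (gradCoord G φ y) =
      sharp G y (hessCoord G φ y u) := by
  apply hi.injective
  ext w
  have hDφ : DifferentiableAt ℝ (fderiv ℝ φ) y :=
    (hφ.fderiv_right (m := 1) (by norm_num)).differentiableAt (by simp)
  have hgrad : DifferentiableAt ℝ (gradCoord G φ) y :=
    (differentiableAt_sharp hG hi).clm_apply hDφ
  have hev : (fun z => G z (gradCoord G φ z) w) =ᶠ[𝓝 y] fun z => fderiv ℝ φ z w := by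
    filter_upwards [eventually_isInvertible hG.continuousAt hi] with z hz
      using metric_gradCoord hz φ w
  have h1 := congrArg (fun l : E →L[ℝ] ℝ => l u) hev.fderiv_eq
  have h2 := (hG.hasFDerivAt.clm_apply hgrad.hasFDerivAt).clm_apply (hasFDerivAt_const w y)
  have h3 := hDφ.hasFDerivAt.clm_apply (hasFDerivAt_const w y)
  rw [h2.fderiv, h3.fderiv] at h1
  simp at h1
  have h4 : G y (sharp G y (hessCoord G φ y u)) w = hessCoord G φ y u w :=
    congrArg (fun l : E →L[ℝ] ℝ => l w) (hi.self_apply_inverse _)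
  rw [h4, hessCoord_apply, ← metric_gradCoord hi φ (christoffel G y u w),
    hs.self_of_nhds (gradCoord G φ y), metric_christoffel hi, map_add,
    add_apply, metric_christoffel hi,
    christoffel₁_apply, christoffel₁_apply]
  rw [fderiv_symm_of_eventually hG hs u w, fderiv_symm_of_eventually hG hs w u,
    fderiv_symm_of_eventually hG hs (gradCoord G φ y) u w]
  linarith [fderiv_symm_of_eventually hG hs u w (gradCoord G φ y)]
end Coordinates

section Warped

variable {E : Type*} [NormedAddCommGroup E] [NormedSpace ℝ E]

/-- The warped metric `-h² dt² ⊕ G` on `ℝ × E`. -/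
noncomputable def warp (G : E → E →L[ℝ] E →L[ℝ] ℝ) (h : E → ℝ) :
    ℝ × E → (ℝ × E) →L[ℝ] (ℝ × E) →L[ℝ] ℝ := fun q =>
  (-(h q.2) ^ 2) • pullForm (ContinuousLinearMap.fst ℝ ℝ E) (ContinuousLinearMap.mul ℝ ℝ)
    + pullForm (ContinuousLinearMap.snd ℝ ℝ E) (G q.2)

theorem warp_apply (G : E → E →L[ℝ] E →L[ℝ] ℝ) (h : E → ℝ) (q v w : ℝ × E) :
    warp G h q v w = -(h q.2) ^ 2 * (v.1 * w.1) + G q.2 v.2 w.2 := rfl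

theorem isInvertible_of_forall_eq_zero [FiniteDimensional ℝ E] {B : E →L[ℝ] E →L[ℝ] ℝ}
    (hB : ∀ v, B v = 0 → v = 0) : B.IsInvertible := by
  have hinj : Function.Injective (B : E →ₗ[ℝ] E →L[ℝ] ℝ) :=
    (injective_iff_map_eq_zero (B : E →ₗ[ℝ] E →L[ℝ] ℝ)).2 hB
  have hfr : Module.finrank ℝ E = Module.finrank ℝ (E →L[ℝ] ℝ) := by
    rw [← (LinearMap.toContinuousLinearMap (𝕜 := ℝ) (E := E) (F' := ℝ)).finrank_eq]
    exact (Subspace.dual_finrank_eq (K := ℝ) (V := E)).symm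
  refine ⟨(LinearEquiv.ofInjectiveOfFinrankEq _ hinj hfr).toContinuousLinearEquiv, ?_⟩
  ext v w
  rfl

/-- The trace of an endomorphism of `ℝ × E` is the sum of the traces of its diagonal blocks. -/
theorem trace_real_prod [FiniteDimensional ℝ E] (A : (ℝ × E) →L[ℝ] (ℝ × E)) (B : E →L[ℝ] E)
    (hB : ∀ x, (A (0, x)).2 = B x) :
    LinearMap.trace ℝ (ℝ × E) (A : (ℝ × E) →ₗ[ℝ] (ℝ × E)) =
      (A (1, 0)).1 + LinearMap.trace ℝ E (B : E →ₗ[ℝ] E) := by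
  set A' : (ℝ × E) →ₗ[ℝ] (ℝ × E) := (A : (ℝ × E) →ₗ[ℝ] (ℝ × E)) with hA'
  have hsplit : A' = (A' ∘ₗ LinearMap.inl ℝ ℝ E) ∘ₗ LinearMap.fst ℝ ℝ E
      + (A' ∘ₗ LinearMap.inr ℝ ℝ E) ∘ₗ LinearMap.snd ℝ ℝ E := by
    ext x <;> simp [← Prod.zero_eq_mk]
  have h1 : LinearMap.fst ℝ ℝ E ∘ₗ A' ∘ₗ LinearMap.inl ℝ ℝ E =
      (A (1, 0)).1 • (LinearMap.id : ℝ →ₗ[ℝ] ℝ) := by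
    ext; simp [hA']
  have h2 : LinearMap.snd ℝ ℝ E ∘ₗ A' ∘ₗ LinearMap.inr ℝ ℝ E = (B : E →ₗ[ℝ] E) := by
    ext x; simp [hA', hB]
  rw [hsplit, map_add, LinearMap.trace_comp_comm', h1,
    LinearMap.trace_comp_comm' (LinearMap.snd ℝ ℝ E), h2]
  simp

variable {G : E → E →L[ℝ] E →L[ℝ] ℝ} {h : E → ℝ} {q : ℝ × E}

theorem contDiffAt_warp {n : WithTop ℕ∞} (hG : ContDiffAt ℝ n G q.2) (hh : ContDiffAt ℝ n h q.2) :
    ContDiffAt ℝ n (warp G h) q := by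
  have hG' : ContDiffAt ℝ n (fun p : ℝ × E => G p.2) q := hG.comp q contDiffAt_snd
  have hh' : ContDiffAt ℝ n (fun p : ℝ × E => h p.2) q := hh.comp q contDiffAt_snd
  refine ((hh'.pow 2).neg.smul contDiffAt_const).add ?_
  have hflip {X Y : Type _} [NormedAddCommGroup X] [NormedSpace ℝ X] [NormedAddCommGroup Y]
      [NormedSpace ℝ Y] {B : ℝ × E → X →L[ℝ] Y →L[ℝ] ℝ} (hB : ContDiffAt ℝ n B q) :
      ContDiffAt ℝ n (fun p => (B p).flip) q :=
    (ContinuousLinearMap.flipₗᵢ ℝ X Y ℝ).toContinuousLinearEquiv.contDiff.contDiffAt.comp q hB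
  exact hflip ((hflip (hG'.clm_comp contDiffAt_const)).clm_comp contDiffAt_const)

theorem isInvertible_warp [FiniteDimensional ℝ E] (hi : (G q.2).IsInvertible) (h0 : h q.2 ≠ 0) :
    (warp G h q).IsInvertible := by
  refine isInvertible_of_forall_eq_zero fun v hv => ?_
  have hv' (w : ℝ × E) : -(h q.2) ^ 2 * (v.1 * w.1) + G q.2 v.2 w.2 = 0 :=
    congrArg (fun l : (ℝ × E) →L[ℝ] ℝ => l w) hv
  refine Prod.ext ?_ (hi.injective ?_)
  · simpa [h0] using hv' (1, 0)
  · ext w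
    simpa using hv' (0, w)

theorem fderiv_warp (hG : DifferentiableAt ℝ G q.2) (hh : DifferentiableAt ℝ h q.2)
    (u v w : ℝ × E) :
    fderiv ℝ (warp G h) q u v w =
      -(2 * h q.2 * fderiv ℝ h q.2 u.2) * (v.1 * w.1) + fderiv ℝ G q.2 u.2 v.2 w.2 := by
  have hG' := hG.hasFDerivAt.comp q hasFDerivAt_snd
  have hh' := hh.hasFDerivAt.comp q hasFDerivAt_snd
  have hW : DifferentiableAt ℝ (warp G h) q := by
    have hflip {X Y : Type _} [NormedAddCommGroup X] [NormedSpace ℝ X] [NormedAddCommGroup Y]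
        [NormedSpace ℝ Y] {B : ℝ × E → X →L[ℝ] Y →L[ℝ] ℝ} (hB : DifferentiableAt ℝ B q) :
        DifferentiableAt ℝ (fun p => (B p).flip) q :=
      (ContinuousLinearMap.flipₗᵢ ℝ X Y ℝ).toContinuousLinearEquiv.differentiableAt.comp q hB
    refine ((hh'.differentiableAt.pow 2).neg.smul (differentiableAt_const _)).add ?_
    exact hflip ((hflip (hG'.differentiableAt.clm_comp (differentiableAt_const _))).clm_comp
      (differentiableAt_const _))
  rw [fderiv_apply_apply hW]
  have h1 := (((hh'.pow 2).neg).mul_const (v.1 * w.1)).add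
    ((hG'.clm_apply (hasFDerivAt_const v.2 q)).clm_apply (hasFDerivAt_const w.2 q))
  refine (congrArg (fun l : (ℝ × E) →L[ℝ] ℝ => l u) h1.fderiv).trans ?_
  simp
  ring

variable [FiniteDimensional ℝ E]

theorem christoffel_warp (hG : DifferentiableAt ℝ G q.2) (hi : (G q.2).IsInvertible)
    (hh : DifferentiableAt ℝ h q.2) (h0 : h q.2 ≠ 0) (v w : ℝ × E) :
    christoffel (warp G h) q v w =
      ((fderiv ℝ h q.2 v.2 * w.1 + fderiv ℝ h q.2 w.2 * v.1) / h q.2,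
        christoffel G q.2 v.2 w.2 + (h q.2 * (v.1 * w.1)) • gradCoord G h q.2) := by
  have hW := isInvertible_warp (q := q) hi h0
  apply hW.injective
  ext z
  · rw [ContinuousLinearMap.comp_apply, ContinuousLinearMap.comp_apply, metric_christoffel hW,
      christoffel₁_apply]
    simp only [fderiv_warp hG hh, warp_apply, ContinuousLinearMap.inl_apply, map_zero,
      zero_apply]
    field_simp
    ring
  · rw [ContinuousLinearMap.comp_apply, ContinuousLinearMap.comp_apply, metric_christoffel hW,
      christoffel₁_apply]
    simp only [fderiv_warp hG hh, warp_apply, ContinuousLinearMap.inr_apply, map_add, map_smul,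
      add_apply, smul_apply, metric_christoffel hi, metric_gradCoord hi, christoffel₁_apply,
      smul_eq_mul]
    ring

theorem fderiv_christoffel_warp (hG : ContDiffAt ℝ 2 G q.2) (hi : (G q.2).IsInvertible)
    (hh : ContDiffAt ℝ 2 h q.2) (h0 : h q.2 ≠ 0) (u v w : ℝ × E) :
    fderiv ℝ (fun p => christoffel (warp G h) p v w) q u =
      (((fderiv ℝ (fderiv ℝ h) q.2 u.2 v.2 * w.1 + fderiv ℝ (fderiv ℝ h) q.2 u.2 w.2 * v.1)
          * h q.2 - (fderiv ℝ h q.2 v.2 * w.1 + fderiv ℝ h q.2 w.2 * v.1)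
            * fderiv ℝ h q.2 u.2) / h q.2 ^ 2,
        fderiv ℝ (christoffel G) q.2 u.2 v.2 w.2 +
          ((v.1 * w.1) • (fderiv ℝ h q.2 u.2 • gradCoord G h q.2
            + h q.2 • fderiv ℝ (gradCoord G h) q.2 u.2))) := by
  have hG1 := hG.differentiableAt (by norm_num)
  have hh1 := hh.differentiableAt (by norm_num)
  have hD : DifferentiableAt ℝ (fderiv ℝ h) q.2 :=
    (hh.fderiv_right (m := 1) (by norm_num)).differentiableAt (by simp)
  have hgrad : DifferentiableAt ℝ (gradCoord G h) q.2 :=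
    (differentiableAt_sharp hG1 hi).clm_apply hD
  have hΓ := differentiableAt_christoffel hG hi
  have hev : (fun p => christoffel (warp G h) p v w) =ᶠ[𝓝 q] fun p =>
      ((fderiv ℝ h p.2 v.2 * w.1 + fderiv ℝ h p.2 w.2 * v.1) / h p.2,
        christoffel G p.2 v.2 w.2 + (h p.2 * (v.1 * w.1)) • gradCoord G h p.2) := by
    have hy : Tendsto (fun p : ℝ × E => p.2) (𝓝 q) (𝓝 q.2) := continuousAt_snd
    filter_upwards [hy.eventually (hG.eventually (by simp)),
      hy.eventually (eventually_isInvertible hG1.continuousAt hi),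
      hy.eventually (hh.eventually (by simp)),
      hy.eventually (hh1.continuousAt.eventually_ne h0)] with p h1 h2 h3 h4
    exact christoffel_warp (h1.differentiableAt (by norm_num)) h2
      (h3.differentiableAt (by norm_num)) h4 v w
  rw [hev.fderiv_eq]
  have d1 (x : E) : HasFDerivAt (fun z => fderiv ℝ h z x) ((fderiv ℝ (fderiv ℝ h) q.2).flip x) q.2 := by
    simpa using hD.hasFDerivAt.clm_apply (hasFDerivAt_const x q.2)
  have d2 : HasFDerivAt (fun z => christoffel G z v.2 w.2)
      (((fderiv ℝ (christoffel G) q.2).flip v.2).flip w.2) q.2 := by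
    simpa using (hΓ.hasFDerivAt.clm_apply (hasFDerivAt_const v.2 q.2)).clm_apply
      (hasFDerivAt_const w.2 q.2)
  have e1 := (((d1 v.2).mul_const w.1).add ((d1 w.2).mul_const v.1)).mul
    ((hasDerivAt_inv h0).comp_hasFDerivAt q.2 hh1.hasFDerivAt)
  have e2 := d2.add ((hh1.hasFDerivAt.mul_const (v.1 * w.1)).smul hgrad.hasFDerivAt)
  have e := (e1.prodMk e2).comp q hasFDerivAt_snd
  refine (congrArg (fun l : (ℝ × E) →L[ℝ] (ℝ × E) => l u) e.fderiv).trans ?_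
  simp
  refine ⟨?_, ?_⟩
  · field_simp
    ring
  · module

/-- The Ricci tensor of the warped metric `-h² dt² ⊕ G`. -/
theorem ricciCoord_warp (hG : ContDiffAt ℝ 2 G q.2)
    (hs : ∀ᶠ z in 𝓝 q.2, ∀ v w, G z v w = G z w v) (hi : (G q.2).IsInvertible)
    (hh : ContDiffAt ℝ 2 h q.2) (h0 : h q.2 ≠ 0) (v w : ℝ × E) :
    ricciCoord (warp G h) q v w =
      v.1 * w.1 * (h q.2 * laplaceCoord G h q.2) + ricciCoord G q.2 v.2 w.2
        - hessCoord G h q.2 v.2 w.2 / h q.2 := by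
  have hG1 := hG.differentiableAt (by norm_num)
  have hh1 := hh.differentiableAt (by norm_num)
  have hΓW := differentiableAt_christoffel (contDiffAt_warp hG hh) (isInvertible_warp hi h0)
  have key := trace_real_prod (curvature (warp G h) q v w)
    (curvature G q.2 v.2 w.2 + (v.1 * w.1 * h q.2) • (sharp G q.2 ∘L hessCoord G h q.2)) (by
      intro x
      have hx := fderiv_gradCoord_add_christoffel hG1 hs hi hh x
      rw [curvature_eq_fderiv_apply hΓW]
      simp only [fderiv_christoffel_warp hG hi hh h0, christoffel_warp hG1 hi hh1 h0,
        add_apply, smul_apply, ContinuousLinearMap.comp_apply,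
        ← hx, curvature_apply, Prod.snd_add, Prod.snd_sub, map_add, map_smul]
      have hc : h q.2 * (v.1 * (fderiv ℝ h q.2 x * w.1 / h q.2)) =
          v.1 * w.1 * fderiv ℝ h q.2 x := by
        field_simp
      simp [hc]
      module)
  have h11 : (curvature (warp G h) q v w (1, 0)).1 = -(hessCoord G h q.2 v.2 w.2 / h q.2) := by
    rw [curvature_eq_fderiv_apply hΓW, hessCoord_apply]
    simp only [fderiv_christoffel_warp hG hi hh h0, christoffel_warp hG1 hi hh1 h0]
    simp
    field_simp
    ring
  rw [ricciCoord, key, h11]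
  simp [ricciCoord, laplaceCoord]
  ring

end Warped

section LocalMetric

variable {E : Type*} [NormedAddCommGroup E] [NormedSpace ℝ E]
  {H : Type*} [TopologicalSpace H] (I : ModelWithCorners ℝ E H)
  {M : Type*} [TopologicalSpace M] [ChartedSpace H M]

theorem coords_eq [IsManifold I 1 M] (p : M) (v : TangentSpace I p) : coords I p v = v := by
  rw [coords, mfderiv_extChartAt_self]
  rfl

theorem mfderiv_extChartAt_symm_self [I.Boundaryless] [IsManifold I 1 M] (p : M) (v : E) :
    mfderiv 𝓘(ℝ, E) I (extChartAt I p).symm (extChartAt I p p) v = v := by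
  have h := mfderivWithin_range_extChartAt_symm (I := I) (x := p)
  rw [I.range_eq_univ, mfderivWithin_univ] at h
  rw [h]
  rfl

theorem localMetric_self [I.Boundaryless] [IsManifold I 1 M] (g : BilinField I M) (p : M)
    (v w : TangentSpace I p) : localMetric I g p (extChartAt I p p) v w = g p v w := by
  have hp : (extChartAt I p).symm (extChartAt I p p) = p := extChartAt_to_inv p
  have key : ∀ (q : M) (a b : E), q = p →
      (g q : E →L[ℝ] E →L[ℝ] ℝ) a b = (g p : E →L[ℝ] E →L[ℝ] ℝ) a b := by
    rintro q a b rfl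
    rfl
  exact (congrArg₂ (fun a b : E => (g ((extChartAt I p).symm (extChartAt I p p)) :
    E →L[ℝ] E →L[ℝ] ℝ) a b) (mfderiv_extChartAt_symm_self I p v)
    (mfderiv_extChartAt_symm_self I p w)).trans (key _ v w hp)

variable {I}

theorem mdifferentiableAt_extChartAt_symm_of_mem [I.Boundaryless] [IsManifold I 1 M] {p : M}
    {z : E} (hz : z ∈ (extChartAt I p).target) :
    MDifferentiableAt 𝓘(ℝ, E) I (extChartAt I p).symm z := by
  have h := mdifferentiableWithinAt_extChartAt_symm hz
  rwa [I.range_eq_univ, mdifferentiableWithinAt_univ] at h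

theorem localMetric_eq_inCoordinates [I.Boundaryless] [IsManifold I 1 M] (g : BilinField I M)
    {p : M} {z : E} (hz : z ∈ (extChartAt I p).target) :
    localMetric I g p z =
      ContinuousLinearMap.inCoordinates E (TangentSpace I : M → Type _) (E →L[ℝ] ℝ)
        (fun x : M => TangentSpace I x →L[ℝ] ℝ) p ((extChartAt I p).symm z) p
        ((extChartAt I p).symm z) (g ((extChartAt I p).symm z)) := by
  have hs : (extChartAt I p).symm z ∈ (chartAt H p).source := by
    simpa using (extChartAt I p).map_target hz
  have hm := TangentBundle.symmL_trivializationAt (I := I) hs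
  rw [I.range_eq_univ, mfderivWithin_univ, (extChartAt I p).right_inv hz] at hm
  have hb : (extChartAt I p).symm z ∈
      (trivializationAt E (TangentSpace I : M → Type _) p).baseSet := by simpa using hs
  ext v w
  have key := inCoordinates_apply_eq₂ (𝕜 := ℝ) (F₁ := E) (F₂ := E) (F₃ := ℝ)
    (E₁ := (TangentSpace I : M → Type _)) (E₂ := (TangentSpace I : M → Type _))
    (E₃ := Bundle.Trivial M ℝ) (x₀ := p) (ϕ := g ((extChartAt I p).symm z)) (v := v) (w := w)
    hb hb (Set.mem_univ _)
  have ha (a : E) : (mfderiv 𝓘(ℝ, E) I (extChartAt I p).symm z a : E) =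
      (trivializationAt E (TangentSpace I : M → Type _) p).symm ((extChartAt I p).symm z) a :=
    (congrArg (fun l : E →L[ℝ] E => l a) hm).symm.trans
      (Bundle.Trivialization.symmL_apply _ hb a)
  refine Eq.trans ?_ key.symm
  refine (congrArg₂ (fun a b : E => (g ((extChartAt I p).symm z) : E →L[ℝ] E →L[ℝ] ℝ) a b)
    (ha v) (ha w)).trans ?_
  exact (congrArg (fun l : ℝ →ₗ[ℝ] ℝ => l _)
    (Bundle.Trivial.linearMapAt_trivialization ℝ M ℝ ((extChartAt I p).symm z))).symm

theorem contDiffAt_localMetric [I.Boundaryless] [IsManifold I ∞ M]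
    (g : Bundle.ContMDiffRiemannianMetric I ∞ E (fun x : M => TangentSpace I x)) (p : M) :
    ContDiffAt ℝ ∞ (localMetric I g.inner p) (extChartAt I p p) := by
  have : IsManifold I 1 M := .of_le (n := ∞) (by simp)
  have hg := ((contMDiffAt_hom_bundle _).1 (g.contMDiff p)).2
  have hp : (extChartAt I p).symm (extChartAt I p p) = p := extChartAt_to_inv p
  have hs : ContMDiffAt 𝓘(ℝ, E) I ∞ (extChartAt I p).symm (extChartAt I p p) :=
    (contMDiffOn_extChartAt_symm p).contMDiffAt (extChartAt_target_mem_nhds p)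
  rw [← hp] at hg
  have hc := (hg.comp (extChartAt I p p) hs).contDiffAt
  rw [hp] at hc
  refine hc.congr_of_eventuallyEq ?_
  filter_upwards [extChartAt_target_mem_nhds (I := I) p] with z hz
  exact localMetric_eq_inCoordinates _ hz

theorem contDiffAt_comp_extChartAt_symm [I.Boundaryless] [IsManifold I ∞ M] {f : M → ℝ}
    (hf : ContMDiff I 𝓘(ℝ, ℝ) ∞ f) (p : M) :
    ContDiffAt ℝ ∞ (f ∘ (extChartAt I p).symm) (extChartAt I p p) := by
  have hs : ContMDiffAt 𝓘(ℝ, E) I ∞ (extChartAt I p).symm (extChartAt I p p) :=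
    (contMDiffOn_extChartAt_symm p).contMDiffAt (extChartAt_target_mem_nhds p)
  exact (hf.contMDiffAt.comp _ hs).contDiffAt

theorem localMetric_symm {g : BilinField I M}
    (hg : ∀ (x : M) (v w : TangentSpace I x), g x v w = g x w v) (p : M) (z v w : E) :
    localMetric I g p z v w = localMetric I g p z w v :=
  hg ((extChartAt I p).symm z) (mfderiv 𝓘(ℝ, E) I (extChartAt I p).symm z v)
    (mfderiv 𝓘(ℝ, E) I (extChartAt I p).symm z w)

theorem isInvertible_localMetric_self [FiniteDimensional ℝ E] [I.Boundaryless] [IsManifold I 1 M]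
    (g : Bundle.ContMDiffRiemannianMetric I ∞ E (fun x : M => TangentSpace I x)) (p : M) :
    (localMetric I g.inner p (extChartAt I p p)).IsInvertible := by
  refine isInvertible_of_forall_eq_zero fun v hv => ?_
  by_contra h0
  have h1 : localMetric I g.inner p (extChartAt I p p) v v = 0 := by rw [hv]; rfl
  exact (g.pos p v h0).ne' ((localMetric_self I g.inner p v v).symm.trans h1)

theorem mfderiv_comp_extChartAt_symm [I.Boundaryless] [IsManifold I 1 M]
    {E' : Type*} [NormedAddCommGroup E'] [NormedSpace ℝ E'] {H' : Type*} [TopologicalSpace H']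
    {I' : ModelWithCorners ℝ E' H'} {M' : Type*} [TopologicalSpace M'] [ChartedSpace H' M']
    {φ : M → M'} (hφ : MDifferentiable I I' φ) {ψ : E → M'} {p : M} {z : E}
    (hz : z ∈ (extChartAt I p).target)
    (h : ∀ y ∈ (extChartAt I p).target, φ ((extChartAt I p).symm y) = ψ y) (v : E) :
    (mfderiv I I' φ ((extChartAt I p).symm z)
      (mfderiv 𝓘(ℝ, E) I (extChartAt I p).symm z v) : E') = mfderiv 𝓘(ℝ, E) I' ψ z v := by
  have hev : φ ∘ (extChartAt I p).symm =ᶠ[𝓝 z] ψ := by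
    filter_upwards [extChartAt_target_mem_nhds' hz] with y hy using h y hy
  rw [← hev.mfderiv_eq, mfderiv_comp z (hφ _) (mdifferentiableAt_extChartAt_symm_of_mem hz)]
  rfl

end LocalMetric

section Static

variable {E : Type*} [NormedAddCommGroup E] [NormedSpace ℝ E]
  {H : Type*} [TopologicalSpace H] {I : ModelWithCorners ℝ E H}
  {M : Type*} [TopologicalSpace M] [ChartedSpace H M]

theorem localMetric_staticMetric [I.Boundaryless] [IsManifold I ∞ M] (t₁ t₂ : EReal)
    (f : M → ℝ) (g : BilinField I M) (p : interval t₁ t₂ × M) {z : ℝ × E}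
    (hz : z ∈ (extChartAt (𝓘(ℝ, ℝ).prod I) p).target) :
    localMetric (𝓘(ℝ, ℝ).prod I) (staticMetric I t₁ t₂ f g) p z =
      warp (localMetric I g p.2) (f ∘ (extChartAt I p.2).symm) z := by
  have : IsManifold I 1 M := .of_le (n := ∞) (by simp)
  have hfst (v : ℝ × E) := mfderiv_comp_extChartAt_symm (I := 𝓘(ℝ, ℝ).prod I) (I' := 𝓘(ℝ, ℝ))
    (φ := fun q : interval t₁ t₂ × M => (q.1 : ℝ)) (ψ := Prod.fst)
    ((contMDiff_subtype_val (n := 1)).mdifferentiable (by simp) |>.comp mdifferentiable_fst) hz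
    (fun y hy => by
      rw [extChartAt_prod] at hy ⊢
      exact (extChartAt 𝓘(ℝ, ℝ) p.1).right_inv hy.1) v
  have hsnd (v : ℝ × E) := mfderiv_comp_extChartAt_symm (I := 𝓘(ℝ, ℝ).prod I) (I' := I)
    (φ := (Prod.snd : interval t₁ t₂ × M → M)) (ψ := fun y => (extChartAt I p.2).symm y.2)
    mdifferentiable_snd hz (fun y hy => by rw [extChartAt_prod]; rfl) v
  have hz2 : z.2 ∈ (extChartAt I p.2).target := by
    rw [extChartAt_prod] at hz
    exact hz.2
  refine ContinuousLinearMap.ext fun v => ContinuousLinearMap.ext fun w => ?_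
  have hfst' (v : ℝ × E) : (mfderiv 𝓘(ℝ, ℝ × E) 𝓘(ℝ, ℝ) (Prod.fst : ℝ × E → ℝ) z v : ℝ) = v.1 := by
    rw [mfderiv_eq_fderiv, fderiv_fst]
    rfl
  have hsnd' (v : ℝ × E) : (mfderiv 𝓘(ℝ, ℝ × E) I (fun y : ℝ × E => (extChartAt I p.2).symm y.2)
      z v : E) = mfderiv 𝓘(ℝ, E) I (extChartAt I p.2).symm z.2 v.2 := by
    have hc := mfderiv_comp (I := 𝓘(ℝ, ℝ × E)) (I' := 𝓘(ℝ, E)) (I'' := I) z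
      (g := (extChartAt I p.2).symm) (f := (Prod.snd : ℝ × E → E))
      (mdifferentiableAt_extChartAt_symm_of_mem hz2) differentiableAt_snd.mdifferentiableAt
    refine (congrArg (fun l : (ℝ × E) →L[ℝ] E => l v) hc).trans ?_
    rw [mfderiv_eq_fderiv, fderiv_snd]
    rfl
  exact congrArg₂ (fun a b : ℝ => a + b)
    (congrArg₂ (fun a b : ℝ => -(f ((extChartAt I p.2).symm z.2)) ^ 2 * (a * b))
      ((hfst v).trans (hfst' v)) ((hfst w).trans (hfst' w)))
    (congrArg₂ (fun a b : E => (g ((extChartAt I p.2).symm z.2) : E →L[ℝ] E →L[ℝ] ℝ) a b)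
      ((hsnd v).trans (hsnd' v)) ((hsnd w).trans (hsnd' w)))

end Static

section Trace

variable {E : Type*} [NormedAddCommGroup E] [NormedSpace ℝ E] [FiniteDimensional ℝ E]

/-- The trace of a positive semi-definite form with respect to a positive definite one is
nonnegative. -/
theorem trace_sharp_comp_nonneg {G : E → E →L[ℝ] E →L[ℝ] ℝ} {y : E} (hi : (G y).IsInvertible)
    (hs : ∀ v w, G y v w = G y w v) (hpos : ∀ v, v ≠ 0 → 0 < G y v v)
    {Q : E →L[ℝ] E →L[ℝ] ℝ} (hQ : ∀ v, 0 ≤ Q v v) :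
    0 ≤ LinearMap.trace ℝ E (sharp G y ∘L Q : E →L[ℝ] E) := by
  let B : LinearMap.BilinForm ℝ E := LinearMap.mk₂ ℝ (fun v w => G y v w)
    (by simp) (by simp) (by simp) (by simp)
  obtain ⟨b, hb⟩ := LinearMap.BilinForm.exists_orthogonal_basis (B := B) ⟨fun v w => hs v w⟩
  rw [LinearMap.trace_eq_matrix_trace ℝ b, Matrix.trace]
  refine Finset.sum_nonneg fun i _ => ?_
  rw [Matrix.diag_apply, LinearMap.toMatrix_apply]
  have hrepr (x : E) : G y x (b i) = b.repr x i * G y (b i) (b i) := by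
    conv_lhs => rw [← b.sum_repr x]
    rw [map_sum, sum_apply, Finset.sum_eq_single i]
    · simp
    · intro j _ hj
      have : G y (b j) (b i) = 0 := hb hj
      simp [this]
    · simp
  have h1 : G y (sharp G y (Q (b i))) (b i) = Q (b i) (b i) :=
    congrArg (fun l : E →L[ℝ] ℝ => l (b i)) (hi.self_apply_inverse _)
  rw [hrepr] at h1
  have h2 := hpos (b i) (b.ne_zero i)
  have h3 := hQ (b i)
  rw [← h1] at h3
  exact nonneg_of_mul_nonneg_left h3 h2

end Trace

section Formulas

variable {E : Type*} [NormedAddCommGroup E] [NormedSpace ℝ E]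
  {H : Type*} [TopologicalSpace H] {I : ModelWithCorners ℝ E H}
  {M : Type*} [TopologicalSpace M] [ChartedSpace H M]

theorem ricci_eq [IsManifold I 1 M] (g : BilinField I M) (p : M) (v w : TangentSpace I p) :
    ricci I g p v w = ricciCoord (localMetric I g p) (extChartAt I p p) v w := by
  rw [ricci, coords_eq, coords_eq]

theorem hessian_eq [IsManifold I 1 M] (g : BilinField I M) (f : M → ℝ) (p : M)
    (v w : TangentSpace I p) :
    hessian I g f p v w =
      hessCoord (localMetric I g p) (f ∘ (extChartAt I p).symm) (extChartAt I p p) v w := by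
  rw [hessian, coords_eq, coords_eq]

theorem tensorL_zero [IsManifold I 1 M] (g : BilinField I M) (f : M → ℝ) (x : M) :
    tensorL I g f x 0 0 = 0 := by
  have hc : curvature (localMetric I g x) (extChartAt I x x) 0 0 = 0 := by
    ext u
    simp [curvature_apply]
  have hr : ricci I g x 0 0 = 0 := by
    rw [ricci_eq]
    refine (congrArg (fun A : E →L[ℝ] E => LinearMap.trace ℝ E (A : E →ₗ[ℝ] E)) hc).trans ?_
    simp
  have hh : hessian I g f x 0 0 = 0 := by
    rw [hessian_eq]
    exact map_zero (hessCoord (localMetric I g x) _ _ (0 : E))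
  rw [tensorL, hr, hh]
  simp

variable [I.Boundaryless] [IsManifold I ∞ M]

theorem staticMetric_self_apply (t₁ t₂ : EReal) (f : M → ℝ) (g : BilinField I M)
    (p : interval t₁ t₂ × M) (a b : ℝ) (v w : E) :
    (staticMetric I t₁ t₂ f g p : (ℝ × E) →L[ℝ] (ℝ × E) →L[ℝ] ℝ) (a, v) (b, w) =
      -(f p.2) ^ 2 * (a * b) + (g p.2 : E →L[ℝ] E →L[ℝ] ℝ) v w := by
  have : IsManifold I 1 M := .of_le (n := ∞) (by simp)
  have h1 := localMetric_self (𝓘(ℝ, ℝ).prod I) (staticMetric I t₁ t₂ f g) p (a, v) (b, w)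
  rw [localMetric_staticMetric t₁ t₂ f g p (mem_extChartAt_target p)] at h1
  have h2 : (extChartAt I p.2).symm (extChartAt I p.2 p.2) = p.2 := extChartAt_to_inv p.2
  have h3 := localMetric_self I g p.2 v w
  refine h1.symm.trans ?_
  refine congrArg₂ (fun a b : ℝ => a + b) ?_ h3
  exact congrArg (fun x => -(f x) ^ 2 * (a * b)) h2

variable [FiniteDimensional ℝ E]

theorem ricci_staticMetric (t₁ t₂ : EReal)
    (g : Bundle.ContMDiffRiemannianMetric I ∞ E (fun x : M => TangentSpace I x))
    {f : M → ℝ} (hf : ContMDiff I 𝓘(ℝ, ℝ) ∞ f) (p : interval t₁ t₂ × M) (hfp : f p.2 ≠ 0)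
    (a b : ℝ) (v w : TangentSpace I p.2) :
    ricci (𝓘(ℝ, ℝ).prod I) (staticMetric I t₁ t₂ f g.inner) p (a, v) (b, w) =
      a * b * (f p.2 * laplacian I g.inner f p.2) + ricci I g.inner p.2 v w
        - hessian I g.inner f p.2 v w / f p.2 := by
  have : IsManifold I 1 M := .of_le (n := ∞) (by simp)
  have hq : (extChartAt (𝓘(ℝ, ℝ).prod I) p p).2 = extChartAt I p.2 p.2 := rfl
  have hfx : (f ∘ (extChartAt I p.2).symm) (extChartAt I p.2 p.2) = f p.2 :=
    congrArg f (extChartAt_to_inv p.2)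
  have hev : localMetric (𝓘(ℝ, ℝ).prod I) (staticMetric I t₁ t₂ f g.inner) p
      =ᶠ[𝓝 (extChartAt (𝓘(ℝ, ℝ).prod I) p p)]
      warp (localMetric I g.inner p.2) (f ∘ (extChartAt I p.2).symm) := by
    filter_upwards [extChartAt_target_mem_nhds (I := 𝓘(ℝ, ℝ).prod I) p] with z hz
      using localMetric_staticMetric t₁ t₂ f g.inner p hz
  have key := ricciCoord_warp (G := localMetric I g.inner p.2)
    (h := f ∘ (extChartAt I p.2).symm) (q := extChartAt (𝓘(ℝ, ℝ).prod I) p p)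
    ((contDiffAt_localMetric g p.2).of_le ENat.LEInfty.out)
    (Eventually.of_forall (localMetric_symm g.symm p.2)) (isInvertible_localMetric_self g p.2)
    ((contDiffAt_comp_extChartAt_symm hf p.2).of_le ENat.LEInfty.out)
    (by rw [hq, hfx]; exact hfp) (a, v) (b, w)
  rw [hq, hfx] at key
  rw [ricci_eq g.inner p.2, hessian_eq]
  exact (ricci_eq (I := 𝓘(ℝ, ℝ).prod I) _ p (a, v) (b, w)).trans
    ((ricciCoord_congr hev (a, v) (b, w)).trans key)

theorem laplacian_nonneg_of_tensorQ
    (g : Bundle.ContMDiffRiemannianMetric I ∞ E (fun x : M => TangentSpace I x))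
    (hdim : 2 ≤ Module.finrank ℝ E) (f : M → ℝ) (x : M) {c : ℝ}
    (hQ : ∀ v : TangentSpace I x, 0 ≤ c * tensorQ I g.inner f x v v) :
    0 ≤ c * laplacian I g.inner f x := by
  have : IsManifold I 1 M := .of_le (n := ∞) (by simp)
  have hi := isInvertible_localMetric_self g x
  set G := localMetric I g.inner x
  set y := extChartAt I x x
  set Hs := hessCoord G (f ∘ (extChartAt I x).symm) y
  have hG (v w : E) : G y v w = (g.inner x : E →L[ℝ] E →L[ℝ] ℝ) v w :=
    localMetric_self I g.inner x v w
  have h := trace_sharp_comp_nonneg (Q := c • (laplacian I g.inner f x • G y - Hs)) hi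
    (localMetric_symm g.symm x y) (fun v hv => (g.pos x v hv).trans_eq (hG v v).symm) (by
      intro v
      have hQv : tensorQ I g.inner f x v v = laplacian I g.inner f x * G y v v - Hs v v :=
        congrArg₂ (fun a b : ℝ => a - b)
          (congrArg (fun r : ℝ => laplacian I g.inner f x * r) (hG v v).symm)
          (hessian_eq g.inner f x v v)
      exact (hQ v).trans_eq (congrArg (fun r : ℝ => c * r) hQv))
  have hcomp : sharp G y ∘L (c • (laplacian I g.inner f x • G y - Hs)) =
      c • (laplacian I g.inner f x • ContinuousLinearMap.id ℝ E - sharp G y ∘L Hs) := by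
    ext v
    have : sharp G y (G y v) = v := hi.inverse_apply_self v
    simp [this]
  have htr : LinearMap.trace ℝ E (sharp G y ∘L Hs : E →L[ℝ] E) = laplacian I g.inner f x := rfl
  rw [hcomp] at h
  simp only [ContinuousLinearMap.toLinearMap_smul, ContinuousLinearMap.toLinearMap_sub,
    ContinuousLinearMap.coe_id, map_smul, map_sub, htr, LinearMap.trace_id,
    smul_eq_mul] at h
  have hn : (2 : ℝ) ≤ Module.finrank ℝ E := by exact_mod_cast hdim
  by_contra! hneg
  nlinarith

end Formulas

section Causality

variable {E : Type*} [NormedAddCommGroup E] [NormedSpace ℝ E] [FiniteDimensional ℝ E]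
  {H : Type*} [TopologicalSpace H] {I : ModelWithCorners ℝ E H} [I.Boundaryless]
  {M : Type*} [TopologicalSpace M] [ChartedSpace H M] [IsManifold I ∞ M]
  (gM : Bundle.ContMDiffRiemannianMetric I ∞ E (fun x : M => TangentSpace I x))
  {f : M → ℝ} (hf : ContMDiff I 𝓘(ℝ, ℝ) ∞ f) (hfpos : ∀ x, 0 < f x) (t₁ t₂ : EReal)

include hf hfpos

/-- On null vectors the Ricci tensor of the space-time is `-f⁻¹ L^* f` of the spatial part. -/
theorem ricci_staticMetric_of_null (p : interval t₁ t₂ × M)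
    (a : ℝ) (v : TangentSpace I p.2) (h : (f p.2 * a) ^ 2 = gM.inner p.2 v v) :
    ricci (𝓘(ℝ, ℝ).prod I) (staticMetric I t₁ t₂ f gM.inner) p (a, v) (a, v) =
      -(tensorL I gM.inner f p.2 v v / f p.2) := by
  have hp := (hfpos p.2).ne'
  rw [ricci_staticMetric t₁ t₂ gM hf p hp a a v v, tensorL, ← h]
  field_simp
  ring

theorem exists_null_lift (t : interval t₁ t₂) (x : M) (v : TangentSpace I x) (hv : v ≠ 0) :
    ∃ w : TangentSpace (𝓘(ℝ, ℝ).prod I) (t, x),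
      IsNull (staticMetric I t₁ t₂ f gM.inner) w ∧
      ricci (𝓘(ℝ, ℝ).prod I) (staticMetric I t₁ t₂ f gM.inner) (t, x) w w =
        -(tensorL I gM.inner f x v v / f x) := by
  have hx := hfpos x
  have hg := gM.pos x v hv
  have ha : (f x * (√(gM.inner x v v) / f x)) ^ 2 = gM.inner x v v := by
    rw [mul_div_cancel₀ _ hx.ne', Real.sq_sqrt hg.le]
  refine ⟨(√(gM.inner x v v) / f x, v), ⟨?_, ?_⟩,
    ricci_staticMetric_of_null gM hf hfpos t₁ t₂ (t, x) _ v ha⟩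
  · refine (staticMetric_self_apply t₁ t₂ f gM.inner (t, x) _ _ v v).trans ?_
    have : -(f x) ^ 2 * ((√(gM.inner x v v) / f x) * (√(gM.inner x v v) / f x)) +
        gM.inner x v v = 0 := by
      linear_combination -ha
    exact this
  · intro h0
    exact hv (congrArg (fun w : ℝ × E => w.2) h0)

theorem forall_null_ricci_iff (ht : t₁ < t₂) (P : ℝ → Prop) (hP : P 0)
    (hmul : ∀ c r : ℝ, 0 < c → (P (c * r) ↔ P r)) :
    (∀ (x : M) (v : TangentSpace I x), P (-tensorL I gM.inner f x v v)) ↔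
      ∀ (p : interval t₁ t₂ × M) (w : TangentSpace (𝓘(ℝ, ℝ).prod I) p),
        IsNull (staticMetric I t₁ t₂ f gM.inner) w →
          P (ricci (𝓘(ℝ, ℝ).prod I) (staticMetric I t₁ t₂ f gM.inner) p w w) := by
  have hscale (x : M) (r : ℝ) : P (-(r / f x)) ↔ P (-r) := by
    rw [← hmul (f x)⁻¹ (-r) (inv_pos.2 (hfpos x))]
    ring_nf
  constructor
  · rintro hL p ⟨a, v⟩ hw
    have h1 := (staticMetric_self_apply t₁ t₂ f gM.inner p a a v v).symm.trans hw.1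
    rw [ricci_staticMetric_of_null gM hf hfpos t₁ t₂ p a v
      (by linear_combination -h1), hscale]
    exact hL p.2 v
  · intro hR x v
    obtain ⟨t, ht1, ht2⟩ := EReal.lt_iff_exists_real_btwn.1 ht
    by_cases hv : v = 0
    · rw [hv, tensorL_zero, neg_zero]
      exact hP
    · obtain ⟨w, hw, hric⟩ := exists_null_lift gM hf hfpos t₁ t₂ ⟨t, ht1, ht2⟩ x v hv
      rw [← hscale, ← hric]
      exact hR _ w hw

theorem negSemidef_tensorL_iff_NCC (ht : t₁ < t₂) :
    NegSemidef (tensorL I gM.inner f) ↔ NCC (staticMetric I t₁ t₂ f gM.inner) := by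
  refine Iff.trans ?_ (forall_null_ricci_iff gM hf hfpos t₁ t₂ ht (fun r => 0 ≤ r) le_rfl
    (fun c r hc => mul_nonneg_iff_of_pos_left hc))
  simp only [NegSemidef, neg_nonneg]

theorem posSemidef_tensorL_iff_RNCC (ht : t₁ < t₂) :
    PosSemidef (tensorL I gM.inner f) ↔ RNCC (staticMetric I t₁ t₂ f gM.inner) := by
  refine Iff.trans ?_ (forall_null_ricci_iff gM hf hfpos t₁ t₂ ht (fun r => r ≤ 0) le_rfl
    (fun c r hc => by simp [mul_nonpos_iff, hc.le, hc.not_ge]))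
  simp only [PosSemidef, neg_nonpos]

/-- The sign of the Ricci tensor on causal vectors: `c = 1` and `c = -1` give the two cases. -/
theorem ricci_nonneg_of_causal (hdim : 2 ≤ Module.finrank ℝ E) (c : ℝ)
    (hR : ∀ (x : M) (v : TangentSpace I x), 0 ≤ c * ricci I gM.inner x v v)
    (hQ : ∀ (x : M) (v : TangentSpace I x), 0 ≤ c * tensorQ I gM.inner f x v v)
    (p : interval t₁ t₂ × M) (w : TangentSpace (𝓘(ℝ, ℝ).prod I) p)
    (hw : IsCausal (staticMetric I t₁ t₂ f gM.inner) w) :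
    0 ≤ c * ricci (𝓘(ℝ, ℝ).prod I) (staticMetric I t₁ t₂ f gM.inner) p w w := by
  obtain ⟨a, v⟩ := w
  have hw' : staticMetric I t₁ t₂ f gM.inner p (a, v) (a, v) ≤ 0 :=
    hw.elim (fun h => le_of_lt h) fun h => h.1.le
  have h1 : -(f p.2) ^ 2 * (a * a) + gM.inner p.2 v v ≤ 0 :=
    (staticMetric_self_apply t₁ t₂ f gM.inner p a a v v).symm.trans_le hw'
  have hp := hfpos p.2
  rw [ricci_staticMetric t₁ t₂ gM hf p hp.ne' a a v v]
  have h2 := laplacian_nonneg_of_tensorQ gM hdim f p.2 (hQ p.2)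
  have h3 : 0 ≤ c * (laplacian I gM.inner f p.2 * gM.inner p.2 v v
      - hessian I gM.inner f p.2 v v) := hQ p.2 v
  have h4 : c * (a * a * (f p.2 * laplacian I gM.inner f p.2) + ricci I gM.inner p.2 v v
        - hessian I gM.inner f p.2 v v / f p.2) =
      c * ricci I gM.inner p.2 v v + (c * laplacian I gM.inner f p.2 *
        ((f p.2) ^ 2 * (a * a) - gM.inner p.2 v v) +
        c * (laplacian I gM.inner f p.2 * gM.inner p.2 v v - hessian I gM.inner f p.2 v v))
          / f p.2 := by
    field_simp
    ring
  rw [h4]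
  have h5 := mul_nonneg h2 (by linarith : 0 ≤ (f p.2) ^ 2 * (a * a) - gM.inner p.2 v v)
  exact add_nonneg (hR p.2 v) (div_nonneg (add_nonneg h5 h3) hp.le)

end Causality

end StaticST

theorem mainTheorem1
    {E : Type*} [NormedAddCommGroup E] [NormedSpace ℝ E] [FiniteDimensional ℝ E]
    {H : Type*} [TopologicalSpace H] (I : ModelWithCorners ℝ E H) [I.Boundaryless]
    {F : Type*} [TopologicalSpace F] [ChartedSpace H F] [IsManifold I ∞ F]
    (gF : Bundle.ContMDiffRiemannianMetric I ∞ E (fun x : F => TangentSpace I x))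
    (hdim : 2 ≤ Module.finrank ℝ E)
    (f : F → ℝ) (hf : ContMDiff I 𝓘(ℝ, ℝ) ∞ f) (hfpos : ∀ x, 0 < f x)
    (t₁ t₂ : EReal) (ht : t₁ < t₂) :
    -- (1)
    ((NegSemidef (tensorL I gF.inner f) ↔ NCC (staticMetric I t₁ t₂ f gF.inner)) ∧
      (PosSemidef (tensorL I gF.inner f) ↔ RNCC (staticMetric I t₁ t₂ f gF.inner))) ∧
    -- (2)
    (PosSemidef (ricci I gF.inner) → PosSemidef (tensorQ I gF.inner f) →
      TCC (staticMetric I t₁ t₂ f gF.inner) ∧ NCC (staticMetric I t₁ t₂ f gF.inner)) ∧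
    -- (3)
    (NegSemidef (ricci I gF.inner) → NegSemidef (tensorQ I gF.inner f) →
      (∀ (p : interval t₁ t₂ × F) (w : TangentSpace (𝓘(ℝ, ℝ).prod I) p),
        IsCausal (staticMetric I t₁ t₂ f gF.inner) w →
          ricci (𝓘(ℝ, ℝ).prod I) (staticMetric I t₁ t₂ f gF.inner) p w w ≤ 0) ∧
      RNCC (staticMetric I t₁ t₂ f gF.inner) ∧ RTCC (staticMetric I t₁ t₂ f gF.inner)) ∧
    -- (4)
    (RicciFlat I gF.inner →
      (PosSemidef (tensorQ I gF.inner f) ↔ NCC (staticMetric I t₁ t₂ f gF.inner))) := by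
  have hN := negSemidef_tensorL_iff_NCC gF hf hfpos t₁ t₂ ht
  refine ⟨⟨hN, posSemidef_tensorL_iff_RNCC gF hf hfpos t₁ t₂ ht⟩, ?_, ?_, ?_⟩
  · intro hR hQ
    have h := ricci_nonneg_of_causal gF hf hfpos t₁ t₂ hdim 1
      (fun x v => (hR x v).trans_eq (one_mul _).symm)
      (fun x v => (hQ x v).trans_eq (one_mul _).symm)
    exact ⟨fun p w hw => (h p w (Or.inl hw)).trans_eq (one_mul _),
      fun p w hw => (h p w (Or.inr hw)).trans_eq (one_mul _)⟩
  · intro hR hQ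
    have h := ricci_nonneg_of_causal gF hf hfpos t₁ t₂ hdim (-1)
      (fun x v => by linarith [hR x v]) (fun x v => by linarith [hQ x v])
    have h' (p : interval t₁ t₂ × F) (w : TangentSpace (𝓘(ℝ, ℝ).prod I) p)
        (hw : IsCausal (staticMetric I t₁ t₂ f gF.inner) w) :
        ricci (𝓘(ℝ, ℝ).prod I) (staticMetric I t₁ t₂ f gF.inner) p w w ≤ 0 := by
      linarith [h p w hw]
    exact ⟨h', fun p w hw => h' p w (Or.inr hw), fun p w hw => h' p w (Or.inl hw)⟩
  · intro hflat
    rw [← hN]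
    refine forall_congr' fun x => forall_congr' fun v => ?_
    rw [tensorL, tensorQ, hflat x v v]
    constructor <;> intro h <;> linarith
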